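/- **Setting.** Let $f_1,\dots,f_N:\mathbb R^n\to\mathbb R$ be differentiable with $\sum_i f_i$ strictly convex, let each agent $i$ have finitely many (possibly no) differentiable convex functions $g_{il}$ and affine functions $h_{ij}$, and consider $$\min_{\mathrm y\in\mathbb R^n}\ \sum_{i=1}^N f_i(\mathrm y)\quad\text{s.t.}\quad g_{il}(\mathrm y)\le 0,\ \ h_{ij}(\mathrm y)=0\ \text{ for all } i,l,j .$$ Slater's condition holds. Put $L_i(\mathrm y,\lambda_i,\mu_i)=f_i(\mathrm y)+\sum_l\lambda_{il}g_{il}(\mathrm y)+\sum_j\mu_{ij}h_{ij}(\mathrm y)$. Agents $i=1,\dots,N$ and controllers $k=1,\dots,K$ are systems $$\dot x_i=\chi_i(x_i,u_i),\quad y_i=\psi_i(x_i,u_i),\qquad \dot z_k=\Phi_k(z_k,\zeta_k),\quad d_k=\sigma_k(z_k),$$ with $x_i\in\mathbb R^{m_i}$, $u_i,y_i,z_k,\zeta_k,d_k\in\mathbb R^n$, where $\chi_i,\psi_i,\sigma_k$ are continuous and $\Phi_k$ is $C^1$. They are interconnected by $u=-(R\otimes I_n)d$, $\zeta=(R\otimes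 I_n)^\top y$ with $R\in\mathbb R^{N\times K}$ and $\ker R^\top=\{\alpha 1_N\mid\alpha\in\mathbb R\}$. For a system $\dot x=\chi(x,u)$, $y=\psi(x,u)$, an equilibrium is a pair $(\bar x,\bar u)$ with $\chi(\bar x,\bar u)=0$; its output is $\bar y=\psi(\bar x,\bar u)$. The system is *equilibrium-independent passive* (EIP) with storage function $V$ if every equilibrium state $\bar x$ has exactly one equilibrium input $\bar u$, $V(\cdot,\bar x)$ is $C^1$, nonnegative and zero at $\bar x$, and for some $\rho,\nu\ge0$ and some $\Psi\ge 0$ with $\Psi(0)=0$, $$\nabla_xV(x,\bar x)^\top\chi(x,u)\le (u-\bar u)^\top(y-\bar y)-\rho\|y-\bar y\|^2-\nu\|u-\bar u\|^2-\Psi(x-\bar x)$$ for all $x,u$ and all equilibria. It is *output-strictly EIP with index* $\rho$ if this holds with that given $\rho\in\mathbb R$. It is *equilibrium-independent observable* (EIO) if, for every equilibrium $(\bar x,\bar u)$, the only trajectory on $[0,\infty)$ under the constant input $\bar u$ with $\psi(x(t),\bar u)=\bar y$ for all $t$ is $x(t)\equiv\bar x$. **Theorem.** Assume: 1. every equilibrium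 $(\bar x_i,\bar u_i)$ of every agent $i$, with output $\bar y_i$, satisfies, for some multipliers $\bar\lambda_i,\bar\mu_i$: $\bar u_i=\nabla_{\mathrm y}L_i(\bar y_i,\bar\lambda_i,\bar\mu_i)$, $g_{il}(\bar y_i)\le0$, $h_{ij}(\bar y_i)=0$, $\bar\lambda_{il}\ge0$, $\bar\lambda_{il}g_{il}(\bar y_i)=0$ (without constraints: $\bar u_i=\nabla f_i(\bar y_i)$); 2. the controllers have integral action: $\Phi_k(\bar z_k,\bar\zeta_k)=0$ implies $\bar\zeta_k=0$; 3. every agent $i$ is EIO and output-strictly EIP with an index $\rho_i>0$ and storage function $S_i$; every controller $k$ is EIO and EIP with storage function $W_k$; for every equilibrium state, the functions $S_i(\cdot,\bar x_i)$ and $W_k(\cdot,\bar z_k)$ are positive definite about it and radially unbounded; 4. the networked system has at least one equilibrium. Then the optimization problem has a unique optimizer $\mathrm y^*$, and every equilibrium of the networked system has outputs in $\mathcal M_{\rm eq}=\{(\bar y,\bar d)\mid \bar y=1_N\otimes \mathrm y^*\}$. For every trajectory of the networked system on $[0,\infty)$: * $y_i(t)\to \mathrm y^*$ as $t\to\infty$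 for every agent $i$; * if moreover for every agent $i$ and every $(x,u)\in\mathbb R^{m_i}\times\mathbb R^n$ at least one of the following holds — some $\bar x$ has $\chi_i(\bar x,u)=0$, or some $\bar u$ has $\chi_i(x,\bar u)=0$ and $\psi_i(x,\bar u)=\psi_i(x,u)$ — then the state $(x(t),z(t))$ converges to an equilibrium of the networked system, and $(y(t),d(t))$ converges to the outputs of that equilibrium, a point of $\mathcal M_{\rm eq}$. -/

import Mathlib

open Filter Topology

noncomputable section

/-- Euclidean space `ℝᵏ`. -/
abbrev Vec (k : ℕ) : Type := EuclideanSpace ℝ (Fin k)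

/-! ### Systems with input and output, and their equilibrium-independent properties -/

/-- The control system `x' = dyn x u`, `y = out x u` with state in `ℝᵐ` and input and output
in `ℝⁿ`. -/
structure ControlSystem (m n : ℕ) where
  dyn : Vec m → Vec n → Vec m
  out : Vec m → Vec n → Vec n

namespace ControlSystem

variable {m n : ℕ} (sys : ControlSystem m n)

/-- `(x, u)` is an equilibrium: `x` is an equilibrium state with equilibrium input `u`. -/
def IsEquilibrium (x : Vec m) (u : Vec n) : Prop := sys.dyn x u = 0

/-- Integral action: no input other than `0` leads to an equilibrium. -/
def HasIntegralAction : Prop := ∀ x u, sys.IsEquilibrium x u → u = 0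

/-- Equilibrium-independent dissipativity with respect to the supply rate `w`, a function of the
errors `u - ū`, `y - ȳ`, `x - x̄`, with the explicit storage function `V`; here `V x x̄` matters
only for equilibrium states `x̄`. Each equilibrium state has exactly one equilibrium input. -/
structure IsEIDissipative (w : Vec n → Vec n → Vec m → ℝ) (V : Vec m → Vec m → ℝ) : Prop where
  unique_input : ∀ x u u', sys.IsEquilibrium x u → sys.IsEquilibrium x u' → u = u'
  contDiff : ∀ x₀ u₀, sys.IsEquilibrium x₀ u₀ → ContDiff ℝ 1 (fun x => V x x₀)
  zero : ∀ x₀ u₀, sys.IsEquilibrium x₀ u₀ → V x₀ x₀ = 0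
  nonneg : ∀ x₀ u₀, sys.IsEquilibrium x₀ u₀ → ∀ x, 0 ≤ V x x₀
  dissipation : ∀ x₀ u₀, sys.IsEquilibrium x₀ u₀ → ∀ x u,
    fderiv ℝ (fun x' => V x' x₀) x (sys.dyn x u)
      ≤ w (u - u₀) (sys.out x u - sys.out x₀ u₀) (x - x₀)

/-- The supply rate `ũᵀỹ - ρ ỹᵀỹ - ν ũᵀũ - Ψ(x̃)`. -/
def passivitySupply (ρ ν : ℝ) (Ψ : Vec m → ℝ) (du dy : Vec n) (dx : Vec m) : ℝ :=
  inner ℝ du dy - ρ * inner ℝ dy dy - ν * inner ℝ du du - Ψ dx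

/-- A positive semidefinite function. -/
def IsPosSemidefFun (Ψ : Vec m → ℝ) : Prop := Ψ 0 = 0 ∧ ∀ x, 0 ≤ Ψ x

/-- Equilibrium-independent passivity (EIP) with storage function `V`. -/
def IsEIP (V : Vec m → Vec m → ℝ) : Prop :=
  ∃ (ρ ν : ℝ) (Ψ : Vec m → ℝ), 0 ≤ ρ ∧ 0 ≤ ν ∧ IsPosSemidefFun Ψ ∧
    sys.IsEIDissipative (passivitySupply ρ ν Ψ) V

/-- Output-strict equilibrium-independent passivity with index `ρ` and storage function `V`. -/
def IsOutputStrictlyEIP (ρ : ℝ) (V : Vec m → Vec m → ℝ) : Prop :=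
  ∃ (ν : ℝ) (Ψ : Vec m → ℝ), 0 ≤ ν ∧ IsPosSemidefFun Ψ ∧
    sys.IsEIDissipative (passivitySupply ρ ν Ψ) V

/-- The storage function is positive definite about every equilibrium state. -/
def IsPosDefStorage (V : Vec m → Vec m → ℝ) : Prop :=
  ∀ x₀ u₀, sys.IsEquilibrium x₀ u₀ → V x₀ x₀ = 0 ∧ ∀ x, x ≠ x₀ → 0 < V x x₀

/-- The storage function is radially unbounded about every equilibrium state. -/
def IsRadiallyUnboundedStorage (V : Vec m → Vec m → ℝ) : Prop :=
  ∀ x₀ u₀, sys.IsEquilibrium x₀ u₀ → Tendsto (fun x => V x x₀) (cocompact (Vec m)) atTop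

/-- Equilibrium-independent observability (EIO): for every equilibrium `(x₀, u₀)`, the only
trajectory under the constant input `u₀` whose output stays equal to the equilibrium output
is `x(t) = x₀`. -/
def IsEIObservable : Prop :=
  ∀ x₀ u₀, sys.IsEquilibrium x₀ u₀ → ∀ x : ℝ → Vec m,
    (∀ t, 0 ≤ t → HasDerivWithinAt x (sys.dyn (x t) u₀) (Set.Ici 0) t) →
    (∀ t, 0 ≤ t → sys.out (x t) u₀ = sys.out x₀ u₀) →
    ∀ t, 0 ≤ t → x t = x₀

/-- For every state `x` and input `u`: `u` is the input of some equilibrium, or `x` is an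
equilibrium state whose equilibrium output is the current output `out x u`. -/
def HasSteadyStates : Prop :=
  ∀ x u, (∃ x₀, sys.IsEquilibrium x₀ u) ∨
    ∃ u₀, sys.IsEquilibrium x u₀ ∧ sys.out x u₀ = sys.out x u

end ControlSystem

/-! ### The distributed optimization problem -/

/-- Data of the problem of minimizing `∑ᵢ fᵢ(y)` over `y ∈ ℝⁿ` subject to `gᵢₗ(y) ≤ 0` and
`hᵢⱼ(y) = aᵢⱼᵀ y + cᵢⱼ = 0`. The numbers `numIneq i`, `numEq i` may be zero; the unconstrained
problem is the case in which all of them are. -/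
structure DistributedProblem (n N : ℕ) where
  f : Fin N → Vec n → ℝ
  numIneq : Fin N → ℕ
  g : ∀ i, Fin (numIneq i) → Vec n → ℝ
  numEq : Fin N → ℕ
  a : ∀ i, Fin (numEq i) → Vec n
  c : ∀ i, Fin (numEq i) → ℝ

namespace DistributedProblem

variable {n N : ℕ} (P : DistributedProblem n N)

/-- The affine equality constraint functions. -/
def h (i : Fin N) (j : Fin (P.numEq i)) (y : Vec n) : ℝ := inner ℝ (P.a i j) y + P.c i j

def objective (y : Vec n) : ℝ := ∑ i, P.f i y

def IsFeasible (y : Vec n) : Prop := (∀ i l, P.g i l y ≤ 0) ∧ ∀ i j, P.h i j y = 0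

def IsGlobalOptimizer (y : Vec n) : Prop :=
  P.IsFeasible y ∧ ∀ y', P.IsFeasible y' → P.objective y ≤ P.objective y'

/-- Standing assumptions: differentiable data, convex inequality constraints, strictly convex
objective, Slater's condition. -/
structure IsRegular : Prop where
  differentiable_f : ∀ i, Differentiable ℝ (P.f i)
  differentiable_g : ∀ i l, Differentiable ℝ (P.g i l)
  convex_g : ∀ i l, ConvexOn ℝ Set.univ (P.g i l)
  strictConvex : StrictConvexOn ℝ Set.univ P.objective
  slater : ∃ y, (∀ i l, P.g i l y < 0) ∧ ∀ i j, P.h i j y = 0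

/-- The Lagrange function `Lᵢ(y, λ, μ)` of agent `i`. -/
def lagrangian (i : Fin N) (lam : Fin (P.numIneq i) → ℝ) (mu : Fin (P.numEq i) → ℝ)
    (y : Vec n) : ℝ :=
  P.f i y + ∑ l, lam l * P.g i l y + ∑ j, mu j * P.h i j y

/-- The local steady-state requirement on an equilibrium input `u` and equilibrium output `y` of
agent `i`. Without constraints it reads `u = ∇ fᵢ(y)`. -/
def LocalOptimality (i : Fin N) (u y : Vec n) : Prop :=
  ∃ (lam : Fin (P.numIneq i) → ℝ) (mu : Fin (P.numEq i) → ℝ),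
    u = gradient (P.lagrangian i lam mu) y ∧
    (∀ l, P.g i l y ≤ 0) ∧ (∀ j, P.h i j y = 0) ∧
    (∀ l, 0 ≤ lam l) ∧ ∀ l, lam l * P.g i l y = 0

end DistributedProblem

/-! ### The networked system -/

/-- Agents `xᵢ' = χᵢ(xᵢ, uᵢ)`, `yᵢ = ψᵢ(xᵢ, uᵢ)`, controllers `zₖ' = Φₖ(zₖ, ζₖ)`, `dₖ = σₖ(zₖ)`,
and the communication matrix `R`. The state of an agent may have any dimension, so that it can
contain multipliers of local constraints. -/
structure Network (n N K : ℕ) (m : Fin N → ℕ) where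
  agent : ∀ i, ControlSystem (m i) n
  ctrlDyn : Fin K → Vec n → Vec n → Vec n
  ctrlOut : Fin K → Vec n → Vec n
  R : Matrix (Fin N) (Fin K) ℝ

namespace Network

variable {n N K : ℕ} {m : Fin N → ℕ} (net : Network n N K m)

/-- Controller `k` as a control system (its output has no feedthrough). -/
def controller (k : Fin K) : ControlSystem n n where
  dyn := net.ctrlDyn k
  out := fun z _ => net.ctrlOut k z

/-- Controller outputs `d`. -/
def d (z : Fin K → Vec n) (k : Fin K) : Vec n := net.ctrlOut k (z k)

/-- Agent inputs `u = -(R ⊗ Iₙ) d`, written blockwise. -/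
def u (z : Fin K → Vec n) (i : Fin N) : Vec n := -∑ k, net.R i k • net.d z k

/-- Agent outputs `y`. -/
def y (x : ∀ i, Vec (m i)) (z : Fin K → Vec n) (i : Fin N) : Vec n :=
  (net.agent i).out (x i) (net.u z i)

/-- Controller inputs `ζ = (R ⊗ Iₙ)ᵀ y`, written blockwise. -/
def ζ (x : ∀ i, Vec (m i)) (z : Fin K → Vec n) (k : Fin K) : Vec n :=
  ∑ i, net.R i k • net.y x z i

/-- The nullspace property `ker Rᵀ = {α 1 | α ∈ ℝ}`. -/
def NullspaceProperty : Prop :=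
  ∀ v : Fin N → ℝ, net.R.transpose.mulVec v = 0 ↔ ∃ α : ℝ, v = fun _ => α

/-- `(x, z)` is an equilibrium of the networked system. -/
def IsEquilibrium (x : ∀ i, Vec (m i)) (z : Fin K → Vec n) : Prop :=
  (∀ i, (net.agent i).dyn (x i) (net.u z i) = 0) ∧ ∀ k, net.ctrlDyn k (z k) (net.ζ x z k) = 0

/-- `(x(t), z(t))`, `t ≥ 0`, is a trajectory of the networked system. -/
def IsTrajectory (x : ℝ → ∀ i, Vec (m i)) (z : ℝ → Fin K → Vec n) : Prop :=
  ∀ t, 0 ≤ t →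
    (∀ i, HasDerivWithinAt (fun s => x s i) ((net.agent i).dyn (x t i) (net.u (z t) i))
      (Set.Ici 0) t) ∧
    ∀ k, HasDerivWithinAt (fun s => z s k) (net.ctrlDyn k (z t k) (net.ζ (x t) (z t) k))
      (Set.Ici 0) t

/-- Regularity of the right-hand sides and output maps. -/
structure IsRegular : Prop where
  continuous_agent_dyn : ∀ i, Continuous fun p : Vec (m i) × Vec n => (net.agent i).dyn p.1 p.2
  continuous_agent_out : ∀ i, Continuous fun p : Vec (m i) × Vec n => (net.agent i).out p.1 p.2
  contDiff_ctrlDyn : ∀ k, ContDiff ℝ 1 fun p : Vec n × Vec n => net.ctrlDyn k p.1 p.2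
  continuous_ctrlOut : ∀ k, Continuous (net.ctrlOut k)

end Network

/-- The manifold of output pairs `(y, d)` with `y = 1_N ⊗ yopt`. -/
def equilibriumManifold {n : ℕ} (N K : ℕ) (yopt : Vec n) :
    Set ((Fin N → Vec n) × (Fin K → Vec n)) :=
  {p | ∀ i, p.1 i = yopt}

end

/-! ### Convex optimization -/

/-! At a network equilibrium, integral action gives `ζ = 0`, and the kernel of `Rᵀ` turns this into
consensus of the outputs. The columns of `R` sum to zero, so the agent inputs do too, and the local
conditions add up to the KKT conditions of the whole problem. These suffice by convexity, and strict
convexity gives uniqueness.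

For convergence, the sum of all storage functions is a Lyapunov function: the interconnection is
power preserving, so its derivative is at most `-∑ ρᵢ ‖yᵢ - y*‖²`, and its sublevel sets are
relatively compact. The agent fields are only continuous, so there need be no flow; LaSalle's
argument is run on limits of time shifts along ultrafilters (`exists_limit_trajectory`). On a limit
trajectory the storage is constant, hence all outputs equal `y*`.

For convergence of the states, a limit trajectory must be shown to start at an equilibrium. There `ζ
= 0`, and `ctrlDyn_zero` shows that controllers are at rest under zero input whatever their state.
So the agents see constant inputs and have constant outputs, and
`ControlSystem.isEquilibrium_of_constant_output` applies. The storage recentred at this limit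
equilibrium decreases and accumulates at zero, so the trajectory converges to it. -/

/-- A critical point of a differentiable convex function is a global minimizer. -/
theorem ConvexOn.le_of_hasFDerivAt_zero {E : Type*} [NormedAddCommGroup E] [NormedSpace ℝ E]
    {F : E → ℝ} (hF : ConvexOn ℝ Set.univ F) {y : E} (hy : HasFDerivAt F (0 : E →L[ℝ] ℝ) y)
    (y' : E) : F y ≤ F y' := by
  have hline : HasDerivAt (AffineMap.lineMap y y' : ℝ → E) (y' - y) 0 :=
    AffineMap.hasDerivAt_lineMap
  have hd : HasDerivAt (F ∘ (AffineMap.lineMap y y' : ℝ → E)) 0 0 := by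
    have h0 : HasFDerivAt F (0 : E →L[ℝ] ℝ) ((AffineMap.lineMap y y' : ℝ → E) 0) := by
      simpa using hy
    simpa using h0.comp_hasDerivAt 0 hline
  have hc : ConvexOn ℝ Set.univ (F ∘ (AffineMap.lineMap y y' : ℝ → E)) := by
    simpa using hF.comp_affineMap (AffineMap.lineMap y y' : ℝ →ᵃ[ℝ] E)
  have h := hc.le_slope_of_hasDerivAt (Set.mem_univ 0) (Set.mem_univ 1) one_pos hd
  simpa [slope_def_field] using h

namespace DistributedProblem

variable {n N : ℕ} {P : DistributedProblem n N}

theorem IsRegular.differentiable_lagrangian (hP : P.IsRegular) (i : Fin N)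
    (lam : Fin (P.numIneq i) → ℝ) (mu : Fin (P.numEq i) → ℝ) :
    Differentiable ℝ (P.lagrangian i lam mu) := by
  have hf := hP.differentiable_f i
  have hg := hP.differentiable_g i
  have hh : ∀ j, Differentiable ℝ fun y : Vec n => inner ℝ (P.a i j) y := fun j =>
    (innerSL ℝ (P.a i j)).differentiable
  unfold lagrangian h
  fun_prop

/-- Affinity allows `r` of either sign: equality multipliers are unrestricted, and `r = ±1` exhibits
the hyperplane as an intersection of two half-spaces. -/
theorem convexOn_h (i : Fin N) (j : Fin (P.numEq i)) (r : ℝ) :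
    ConvexOn ℝ Set.univ fun y => r * P.h i j y := by
  refine ⟨convex_univ, fun x _ y _ a b _ _ hab => le_of_eq ?_⟩
  simp only [h, inner_add_right, inner_smul_right, smul_eq_mul]
  linear_combination (-r * P.c i j) * hab

theorem convexOn_finset_sum {ι E : Type*} [AddCommGroup E] [Module ℝ E] (s : Finset ι)
    {F : ι → E → ℝ} (hF : ∀ i ∈ s, ConvexOn ℝ Set.univ (F i)) :
    ConvexOn ℝ Set.univ fun y => ∑ i ∈ s, F i y := by
  classical
  induction s using Finset.induction_on with
  | empty => simpa using convexOn_const (0 : ℝ) convex_univ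
  | insert a s ha ih =>
    simp only [Finset.sum_insert ha]
    exact (hF a (Finset.mem_insert_self a s)).add
      (ih fun i hi => hF i (Finset.mem_insert_of_mem hi))

/-- The individual `P.f i` need not be convex, so convexity appears only after summing over the
agents. -/
theorem convexOn_sum_lagrangian (hP : P.IsRegular) {lam : ∀ i, Fin (P.numIneq i) → ℝ}
    (hlam : ∀ i l, 0 ≤ lam i l) (mu : ∀ i, Fin (P.numEq i) → ℝ) :
    ConvexOn ℝ Set.univ fun y => ∑ i, P.lagrangian i (lam i) (mu i) y := by
  have h1 : ConvexOn ℝ Set.univ fun y => ∑ i, ∑ l, lam i l * P.g i l y :=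
    convexOn_finset_sum _ fun i _ => convexOn_finset_sum _ fun l _ => by
      simpa using (hP.convex_g i l).smul (hlam i l)
  have h2 : ConvexOn ℝ Set.univ fun y => ∑ i, ∑ j, mu i j * P.h i j y :=
    convexOn_finset_sum _ fun i _ => convexOn_finset_sum _ fun j _ => convexOn_h i j _
  have h3 := (hP.strictConvex.convexOn.add h1).add h2
  refine h3.congr fun y _ => ?_
  simp [lagrangian, objective, Finset.sum_add_distrib]

/-- Local optimality conditions at a common point whose gradients add up to zero are the
Karush-Kuhn-Tucker conditions, which are sufficient for global optimality. -/
theorem isGlobalOptimizer_of_localOptimality (hP : P.IsRegular) {u : Fin N → Vec n} {y : Vec n}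
    (h : ∀ i, P.LocalOptimality i (u i) y) (hu : ∑ i, u i = 0) : P.IsGlobalOptimizer y := by
  choose lam mu hgrad hg hh hlam hcompl using h
  refine ⟨⟨hg, hh⟩, fun y' hy' => ?_⟩
  have hder : HasFDerivAt (fun y => ∑ i, P.lagrangian i (lam i) (mu i) y)
      (0 : Vec n →L[ℝ] ℝ) y := by
    have h1 : HasFDerivAt (fun y => ∑ i, P.lagrangian i (lam i) (mu i) y)
        (∑ i, InnerProductSpace.toDual ℝ (Vec n) (u i)) y :=
      HasFDerivAt.fun_sum fun i _ => by
        rw [hgrad i]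
        exact ((hP.differentiable_lagrangian i (lam i) (mu i)) y).hasGradientAt.hasFDerivAt
    rwa [← map_sum, hu, map_zero] at h1
  have hmin := (convexOn_sum_lagrangian hP hlam mu).le_of_hasFDerivAt_zero hder y'
  -- At `y` complementary slackness removes the multiplier terms; at a feasible `y'` they are
  -- nonpositive.
  calc P.objective y = ∑ i, P.lagrangian i (lam i) (mu i) y := by
        simp [objective, lagrangian, hcompl, hh]
    _ ≤ ∑ i, P.lagrangian i (lam i) (mu i) y' := hmin
    _ ≤ P.objective y' := by
        refine Finset.sum_le_sum fun i _ => ?_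
        have h1 : ∑ l, lam i l * P.g i l y' ≤ 0 :=
          Finset.sum_nonpos fun l _ => mul_nonpos_of_nonneg_of_nonpos (hlam i l) (hy'.1 i l)
        simp only [lagrangian, hy'.2, mul_zero, Finset.sum_const_zero]
        linarith

theorem convex_feasible (hP : P.IsRegular) : Convex ℝ {y | P.IsFeasible y} := by
  have hset : {y | P.IsFeasible y}
      = (⋂ i, ⋂ l, {y | P.g i l y ≤ 0}) ∩ ⋂ i, ⋂ j, {y | P.h i j y = 0} := by
    ext y; simp [IsFeasible]
  rw [hset]
  refine (convex_iInter fun i => convex_iInter fun l => ?_).inter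
    (convex_iInter fun i => convex_iInter fun j => ?_)
  · simpa using (hP.convex_g i l).convex_le 0
  · have h1 := (convexOn_h (P := P) i j 1).convex_le 0
    have h2 := (convexOn_h (P := P) i j (-1)).convex_le 0
    convert h1.inter h2 using 1
    ext y
    simp [le_antisymm_iff]

theorem IsGlobalOptimizer.unique (hP : P.IsRegular) {y y' : Vec n} (h : P.IsGlobalOptimizer y)
    (h' : P.IsGlobalOptimizer y') : y' = y :=
  (hP.strictConvex.subset (Set.subset_univ _) (convex_feasible hP)).eq_of_isMinOn
    (isMinOn_iff.2 h'.2) (isMinOn_iff.2 h.2) h'.1 h.1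

end DistributedProblem

/-! ### Controllers with integral action -/

/-- Small multiples of a vector are gradients of a function that has a strict minimum at `e`. -/
theorem exists_fderiv_eq_smul_inner {E : Type*} [NormedAddCommGroup E] [InnerProductSpace ℝ E]
    [ProperSpace E] {V : E → ℝ} (hV : Differentiable ℝ V) {e : E} (h0 : V e = 0)
    (hpos : ∀ z, z ≠ e → 0 < V z) (q : E) {ε : ℝ} (hε : 0 < ε) :
    ∃ lam : ℝ, 0 < lam ∧ ∃ z, dist z e < ε ∧ fderiv ℝ V z = lam • innerSL ℝ q := by
  -- The slope is chosen so small that the tilted function `V - lam * ⟨q, · - e⟩` is positive on the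
  -- sphere, where `V` has a positive minimum. In dimension zero the sphere is empty.
  have hlam : ∃ lam : ℝ, 0 < lam ∧ ∀ z ∈ Metric.sphere e ε, lam * inner ℝ q (z - e) < V z := by
    rcases (Metric.sphere e ε).eq_empty_or_nonempty with hemp | hne
    · exact ⟨1, one_pos, by simp [hemp]⟩
    · obtain ⟨w, hw, hmin⟩ := (isCompact_sphere e ε).exists_isMinOn hne hV.continuous.continuousOn
      have hw0 : 0 < V w := hpos w fun h => by
        rw [h, Metric.mem_sphere, dist_self] at hw; exact hε.ne hw
      refine ⟨V w / (‖q‖ * ε + 1), by positivity, fun z hz => ?_⟩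
      have hVz : V w ≤ V z := hmin hz
      have hin : inner ℝ q (z - e) ≤ ‖q‖ * ε := by
        refine (real_inner_le_norm _ _).trans_eq ?_
        rw [← dist_eq_norm, Metric.mem_sphere.1 hz]
      refine lt_of_lt_of_le ?_ hVz
      rw [div_mul_eq_mul_div, div_lt_iff₀ (by positivity)]
      nlinarith
  obtain ⟨lam, hlam0, hlam⟩ := hlam
  refine ⟨lam, hlam0, ?_⟩
  have hd : ∀ z, HasFDerivAt (fun z => V z - lam * inner ℝ q (z - e))
      (fderiv ℝ V z - lam • innerSL ℝ q) z := fun z =>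
    (hV z).hasFDerivAt.sub
      ((((innerSL ℝ q).hasFDerivAt (x := z - e)).comp z ((hasFDerivAt_id z).sub_const e)).const_mul
        lam)
  have hcont : Continuous fun z => V z - lam * inner ℝ q (z - e) :=
    continuous_iff_continuousAt.2 fun z => (hd z).continuousAt
  -- The tilted function vanishes at `e` and is positive on the sphere, so its minimum over the ball
  -- is interior, hence critical.
  obtain ⟨z, hz, hmin⟩ := (isCompact_closedBall e ε).exists_isMinOn
    (Metric.nonempty_closedBall.2 hε.le) hcont.continuousOn
  have hze : V z - lam * inner ℝ q (z - e) ≤ 0 := by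
    simpa [h0] using hmin (Metric.mem_closedBall_self hε.le)
  have hlt : dist z e < ε := by
    refine lt_of_le_of_ne (Metric.mem_closedBall.1 hz) fun h => ?_
    linarith [hlam z h]
  refine ⟨z, hlt, ?_⟩
  have hloc : IsLocalMin (fun z => V z - lam * inner ℝ q (z - e)) z :=
    hmin.isLocalMin (Filter.mem_of_superset (Metric.isOpen_ball.mem_nhds hlt)
      Metric.ball_subset_closedBall)
  exact sub_eq_zero.1 (hloc.hasFDerivAt_eq_zero (hd z))

/-- A system without feedthrough that is passive about the equilibrium `(e, 0)` with a positive
definite storage function has linear input dependence at `e`. -/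
theorem dyn_eq_fderiv_of_passive {n : ℕ} {Φ : Vec n × Vec n → Vec n} (hΦ : ContDiff ℝ 1 Φ)
    {σ : Vec n → Vec n} {V : Vec n → ℝ} (hV : Differentiable ℝ V) {e : Vec n} (h0 : V e = 0)
    (hpos : ∀ z, z ≠ e → 0 < V z) (he : Φ (e, 0) = 0)
    (hpass : ∀ z ζ, fderiv ℝ V z (Φ (z, ζ)) ≤ inner ℝ ζ (σ z)) (ζ : Vec n) :
    Φ (e, ζ) = fderiv ℝ Φ (e, 0) (0, ζ) := by
  have hc := hΦ.continuous
  -- At points `z` near `e` where the gradient of `V` is a positive multiple of `q`, add `s` times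
  -- the passivity inequality for `ζ` to the one for `-(s • ζ)`: the terms with `σ z` cancel.
  -- Continuity carries the result to `e`.
  have key : ∀ (q : Vec n) (s : ℝ), 0 < s →
      s * inner ℝ q (Φ (e, ζ)) + inner ℝ q (Φ (e, -(s • ζ))) ≤ 0 := by
    intro q s hs
    by_contra! hcon
    have hopen : ∀ᶠ z in 𝓝 e,
        0 < s * inner ℝ q (Φ (z, ζ)) + inner ℝ q (Φ (z, -(s • ζ))) :=
      (ContinuousAt.eventually_lt continuousAt_const
        (Continuous.continuousAt (by fun_prop)) hcon)
    obtain ⟨ε, hε, hball⟩ := Metric.eventually_nhds_iff.1 hopen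
    obtain ⟨lam, hlam, z, hz, hzd⟩ := exists_fderiv_eq_smul_inner hV h0 hpos q hε
    have h1 := hpass z ζ
    have h2 := hpass z (-(s • ζ))
    simp only [hzd, _root_.smul_apply, innerSL_apply_apply, smul_eq_mul,
      inner_neg_left, real_inner_smul_left] at h1 h2
    nlinarith [hball hz, mul_le_mul_of_nonneg_left h1 hs.le]
  have hder : HasDerivAt (fun s : ℝ => Φ (e, -(s • ζ))) (-(fderiv ℝ Φ (e, 0) (0, ζ))) 0 := by
    have h1 : HasDerivAt (fun s : ℝ => (e, -(s • ζ))) ((0 : Vec n), -ζ) 0 := by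
      have h := ((hasDerivAt_id (0 : ℝ)).smul_const ζ).fun_neg
      simp only [one_smul, id_eq] at h
      exact (hasDerivAt_const 0 e).prodMk h
    have h2 : HasFDerivAt Φ (fderiv ℝ Φ (e, 0)) (e, -((0 : ℝ) • ζ)) := by
      simpa using ((hΦ.differentiable one_ne_zero) (e, 0)).hasFDerivAt
    have h3 := h2.comp_hasDerivAt 0 h1
    have h4 : ((0 : Vec n), -ζ) = -(0, ζ) := by simp
    rw [h4, map_neg] at h3
    exact h3
  -- Divide `key` by `s` and let `s → 0⁺`. As `q` is arbitrary, it may then be taken to be the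
  -- difference itself, which must vanish.
  have hle : ∀ q : Vec n, inner ℝ q (Φ (e, ζ) - fderiv ℝ Φ (e, 0) (0, ζ)) ≤ 0 := by
    intro q
    have hslope := hder.tendsto_slope_zero_right
    have hlim : Tendsto (fun s : ℝ => inner ℝ q (Φ (e, ζ))
        + inner ℝ q (s⁻¹ • (Φ (e, -((0 + s) • ζ)) - Φ (e, -((0 : ℝ) • ζ))))) (𝓝[>] 0)
        (𝓝 (inner ℝ q (Φ (e, ζ)) + inner ℝ q (-(fderiv ℝ Φ (e, 0) (0, ζ))))) :=
      tendsto_const_nhds.add (tendsto_const_nhds.inner hslope)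
    have hle := le_of_tendsto hlim (b := 0) ?_
    · rw [inner_neg_right] at hle
      rw [inner_sub_right]
      linarith
    · filter_upwards [self_mem_nhdsWithin] with s hs
      have hs : 0 < s := hs
      have := key q s hs
      simp only [zero_add, zero_smul, neg_zero, he, sub_zero, real_inner_smul_right]
      have h5 : inner ℝ q (Φ (e, ζ)) + s⁻¹ * inner ℝ q (Φ (e, -(s • ζ)))
          = s⁻¹ * (s * inner ℝ q (Φ (e, ζ)) + inner ℝ q (Φ (e, -(s • ζ)))) := by
        field_simp
      rw [h5]
      exact mul_nonpos_of_nonneg_of_nonpos (by positivity) this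
  have h6 := hle (Φ (e, ζ) - fderiv ℝ Φ (e, 0) (0, ζ))
  rw [real_inner_self_eq_norm_sq] at h6
  have h7 : ‖Φ (e, ζ) - fderiv ℝ Φ (e, 0) (0, ζ)‖ = 0 := by
    nlinarith [norm_nonneg (Φ (e, ζ) - fderiv ℝ Φ (e, 0) (0, ζ))]
  exact sub_eq_zero.1 (norm_eq_zero.1 h7)

namespace Network

variable {n N K : ℕ} {m : Fin N → ℕ} {net : Network n N K m}

/-- A passive controller with integral action that has some equilibrium is at rest at every state
when its input vanishes. -/
theorem ctrlDyn_zero (hnet : net.IsRegular) {k : Fin K}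
    (hctrl : (net.controller k).HasIntegralAction) {W : Vec n → Vec n → ℝ}
    (hW : (net.controller k).IsEIP W) (hWpos : (net.controller k).IsPosDefStorage W)
    {z₀ : Vec n} (hz₀ : net.ctrlDyn k z₀ 0 = 0) (z : Vec n) : net.ctrlDyn k z 0 = 0 := by
  set Φ : Vec n × Vec n → Vec n := fun p => net.ctrlDyn k p.1 p.2 with hΦdef
  have hΦ : ContDiff ℝ 1 Φ := hnet.contDiff_ctrlDyn k
  have hint : ∀ z ζ, Φ (z, ζ) = 0 → ζ = 0 := hctrl
  obtain ⟨ρ, ν, Ψ, hρ, hν, hΨ, hd⟩ := hW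
  have hclosed : IsClosed {z | Φ (z, 0) = 0} :=
    isClosed_eq (hΦ.continuous.comp (by fun_prop)) continuous_const
  -- Near a rest point `e`, the implicit function theorem solves `Φ (z, ζ) = 0` for `ζ`, and
  -- integral action forces the solution to be `0`. The theorem needs the partial derivative `B` in
  -- `ζ` to be invertible. Since `Φ (e, ζ) = B ζ`, integral action makes `B` injective, and the
  -- dimensions agree.
  have hopen : IsOpen {z | Φ (z, 0) = 0} := by
    refine isOpen_iff_mem_nhds.2 fun e he => ?_
    have he : Φ (e, 0) = 0 := he
    have heq : (net.controller k).IsEquilibrium e 0 := he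
    have hlin : ∀ ζ, Φ (e, ζ) = fderiv ℝ Φ (e, 0) (0, ζ) := by
      refine dyn_eq_fderiv_of_passive hΦ ((hd.contDiff e 0 heq).differentiable one_ne_zero)
        (hd.zero e 0 heq) (hWpos e 0 heq).2 he (σ := fun z => net.ctrlOut k z - net.ctrlOut k e) ?_
      intro z ζ
      refine (hd.dissipation e 0 heq z ζ).trans ?_
      simp only [ControlSystem.passivitySupply, controller, sub_zero]
      have h1 := mul_nonneg hρ (real_inner_self_nonneg (x := net.ctrlOut k z - net.ctrlOut k e))
      have h2 := mul_nonneg hν (real_inner_self_nonneg (x := ζ))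
      have h3 := hΨ.2 (z - e)
      linarith
    have hstrict : HasStrictFDerivAt Φ (fderiv ℝ Φ (e, 0)) (e, 0) :=
      hΦ.contDiffAt.hasStrictFDerivAt one_ne_zero
    set B : Vec n →L[ℝ] Vec n := fderiv ℝ Φ (e, 0) ∘L .inr ℝ (Vec n) (Vec n) with hB
    have hBinj : Function.Injective B := by
      refine (injective_iff_map_eq_zero B).2 fun ζ hζ => hint e ζ ?_
      rw [hlin]
      simpa [hB] using hζ
    have hinv : B.IsInvertible :=
      ⟨(LinearEquiv.ofInjectiveEndo B.toLinearMap hBinj).toContinuousLinearEquiv, by ext; rfl⟩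
    filter_upwards [hstrict.eventually_apply_implicitFunctionOfProdDomain hinv] with z hz
    rw [he] at hz
    have := hint _ _ hz
    rw [this] at hz
    exact hz
  have huniv : {z | Φ (z, 0) = 0} = Set.univ := IsClopen.eq_univ ⟨hclosed, hopen⟩ ⟨z₀, hz₀⟩
  exact huniv.symm.subset (Set.mem_univ z)

end Network

/-! ### Trajectories on `[0, ∞)` -/

theorem antitoneOn_Ici_of_hasDerivWithinAt_nonpos {g g' : ℝ → ℝ}
    (hg : ∀ t, 0 ≤ t → HasDerivWithinAt g (g' t) (Set.Ici 0) t) (hg' : ∀ t, 0 ≤ t → g' t ≤ 0) :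
    AntitoneOn g (Set.Ici 0) :=
  antitoneOn_of_hasDerivWithinAt_nonpos (convex_Ici 0)
    (fun t ht => (hg t ht).continuousWithinAt)
    (fun t ht => (hg t (interior_subset ht)).mono interior_subset)
    fun t ht => hg' t (interior_subset ht)

/-- A function on `[0, ∞)` that is bounded below has no negative upper bound of its derivative. -/
theorem nonneg_of_hasDerivWithinAt_le {g g' : ℝ → ℝ} {c : ℝ}
    (hg : ∀ t, 0 ≤ t → HasDerivWithinAt g (g' t) (Set.Ici 0) t) (hg' : ∀ t, 0 ≤ t → g' t ≤ c)
    (h0 : ∀ t, 0 ≤ t → 0 ≤ g t) : 0 ≤ c := by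
  by_contra! hc
  have hanti : AntitoneOn (fun t => g t - t * c) (Set.Ici 0) :=
    antitoneOn_Ici_of_hasDerivWithinAt_nonpos
      (fun t ht => (hg t ht).sub ((hasDerivWithinAt_id t _).mul_const c))
      fun t ht => by linarith [hg' t ht]
  -- By this time the linear upper bound `g 0 + t * c` has fallen to `-1`.
  have hT : 0 ≤ (g 0 + 1) / -c := div_nonneg (by linarith [h0 0 le_rfl]) (by linarith)
  have h1 := hanti (Set.mem_Ici.2 le_rfl) (Set.mem_Ici.2 hT) hT
  have h2 := h0 _ hT
  have h3 : (g 0 + 1) / -c * c = -(g 0 + 1) := by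
    rw [div_neg, neg_mul, div_mul_cancel₀ _ hc.ne]
  simp only [h3, zero_mul, sub_zero] at h1
  linarith

theorem AntitoneOn.exists_tendsto_atTop {g : ℝ → ℝ} (hg : AntitoneOn g (Set.Ici 0))
    (h0 : ∀ t, 0 ≤ t → 0 ≤ g t) : ∃ L, Tendsto g atTop (𝓝 L) := by
  have hanti : Antitone fun t => g (max t 0) := fun a b hab =>
    hg (Set.mem_Ici.2 (le_max_right _ _)) (Set.mem_Ici.2 (le_max_right _ _))
      (max_le_max hab le_rfl)
  refine ⟨_, (tendsto_atTop_ciInf hanti ⟨0, ?_⟩).congr' ?_⟩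
  · rintro _ ⟨t, rfl⟩
    exact h0 _ (le_max_right _ _)
  · filter_upwards [eventually_ge_atTop 0] with t ht
    rw [max_eq_left ht]

/-- The shifts of a precompact trajectory of a continuous vector field converge, along every
ultrafilter of times tending to infinity, to a trajectory. -/
theorem exists_limit_trajectory {E : Type*} [NormedAddCommGroup E] [NormedSpace ℝ E] {f : E → E}
    (hf : Continuous f) {X : ℝ → E}
    (hX : ∀ t, 0 ≤ t → HasDerivWithinAt X (f (X t)) (Set.Ici 0) t)
    {C : Set E} (hC : IsCompact C) (hXC : ∀ t, 0 ≤ t → X t ∈ C)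
    {U : Ultrafilter ℝ} (hU : (U : Filter ℝ) ≤ atTop) :
    ∃ Y : ℝ → E, (∀ s, 0 ≤ s → Tendsto (fun t => X (t + s)) U (𝓝 (Y s))) ∧
      ∀ s, 0 ≤ s → HasDerivWithinAt Y (f (Y s)) (Set.Ici 0) s := by
  have hU0 : ∀ᶠ t in (U : Filter ℝ), 0 ≤ t := hU (eventually_ge_atTop 0)
  -- A single ultrafilter gives limits for all shifts `s` at once, with no extraction of
  -- subsequences. Negative `s` get the dummy value `0`.
  have hlim : ∀ s, ∃ y, 0 ≤ s → Tendsto (fun t => X (t + s)) U (𝓝 y) := by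
    intro s
    rcases le_or_gt 0 s with hs | hs
    · obtain ⟨y, -, hy⟩ := hC.ultrafilter_le_nhds (U.map fun t => X (t + s)) <| by
        rw [le_principal_iff]
        exact hU0.mono fun t ht => hXC _ (add_nonneg ht hs)
      exact ⟨y, fun _ => hy⟩
    · exact ⟨0, fun h => absurd h hs.not_ge⟩
  choose Y hY using hlim
  refine ⟨Y, hY, fun s hs => ?_⟩
  obtain ⟨M, hM⟩ := hC.exists_bound_of_continuousOn hf.continuousOn
  have hM0 : 0 ≤ M := (norm_nonneg _).trans (hM _ (hXC 0 le_rfl))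
  have hshift : ∀ t τ, 0 ≤ t → 0 ≤ τ →
      HasDerivWithinAt (fun τ => X (t + τ)) (f (X (t + τ))) (Set.Ici 0) τ := by
    intro t τ ht hτ
    have h1 : HasDerivWithinAt (fun τ : ℝ => t + τ) 1 (Set.Ici 0) τ :=
      (hasDerivWithinAt_id τ _).const_add t
    have h2 := (hX (t + τ) (add_nonneg ht hτ)).scomp τ h1
      fun r hr => Set.mem_Ici.2 (add_nonneg ht hr)
    rwa [one_smul] at h2
  rw [hasDerivWithinAt_iff_isLittleO, Asymptotics.isLittleO_iff]
  intro c hc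
  obtain ⟨δ, hδ, hball⟩ := Metric.continuous_iff.1 hf (Y s) c hc
  -- `M` bounds the speed on `C`, so within this time `X` moves by at most `δ / 2`; the other `δ /
  -- 2` is the distance from `X (t + s)` to `Y s`.
  have hε : 0 < δ / (2 * (M + 1)) := by positivity
  filter_upwards [self_mem_nhdsWithin, mem_nhdsWithin_of_mem_nhds (Metric.ball_mem_nhds s hε)]
    with r hr hrs
  have hr : 0 ≤ r := hr
  have hseg : ∀ τ ∈ Set.uIcc s r, 0 ≤ τ := fun τ hτ => (le_min hs hr).trans hτ.1
  have hbound : ∀ᶠ t in (U : Filter ℝ),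
      ‖X (t + r) - X (t + s) - (r - s) • f (Y s)‖ ≤ c * ‖r - s‖ := by
    filter_upwards [hU0, (hY s hs).eventually (Metric.ball_mem_nhds (Y s) (half_pos hδ))]
      with t ht hts
    have hclose : ∀ τ ∈ Set.uIcc s r, dist (X (t + τ)) (Y s) < δ := by
      intro τ hτ
      have h1 : ‖X (t + τ) - X (t + s)‖ ≤ M * ‖τ - s‖ :=
        Convex.norm_image_sub_le_of_norm_hasDerivWithin_le (f := fun τ => X (t + τ))
          (s := Set.uIcc s r)
          (fun v hv => (hshift t v ht (hseg v hv)).mono fun w hw => hseg w hw)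
          (fun v hv => hM _ (hXC _ (add_nonneg ht (hseg v hv)))) (convex_uIcc s r)
          Set.left_mem_uIcc hτ
      have h2 : ‖τ - s‖ ≤ δ / (2 * (M + 1)) :=
        (Set.abs_sub_left_of_mem_uIcc hτ).trans (by
          rw [← Real.norm_eq_abs, ← dist_eq_norm]; exact (Metric.mem_ball.1 hrs).le)
      have h3 : M * ‖τ - s‖ ≤ δ / 2 := by
        calc M * ‖τ - s‖ ≤ (M + 1) * (δ / (2 * (M + 1))) := by gcongr; linarith
          _ = δ / 2 := by field_simp
      calc dist (X (t + τ)) (Y s) ≤ dist (X (t + τ)) (X (t + s)) + dist (X (t + s)) (Y s) :=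
            dist_triangle _ _ _
        _ < δ / 2 + δ / 2 := by
            rw [dist_eq_norm (X (t + τ))]
            exact add_lt_add_of_le_of_lt (h1.trans h3) hts
        _ = δ := add_halves δ
    -- Subtracting the linear motion with velocity `f (Y s)` leaves a derivative of norm at most
    -- `c`. The resulting bound is uniform in `t`, so it survives the limit along `U`.
    have h4 := Convex.norm_image_sub_le_of_norm_hasDerivWithin_le
      (f := fun τ => X (t + τ) - τ • f (Y s)) (s := Set.uIcc s r) (C := c)
      (f' := fun τ => f (X (t + τ)) - (1 : ℝ) • f (Y s))
      (fun v hv => ((hshift t v ht (hseg v hv)).mono fun w hw => hseg w hw).fun_sub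
        ((hasDerivWithinAt_id v _).smul_const (f (Y s))))
      (fun v hv => by
        rw [one_smul, ← dist_eq_norm]
        exact (hball _ (hclose v hv)).le) (convex_uIcc s r) Set.left_mem_uIcc Set.right_mem_uIcc
    refine le_of_eq_of_le ?_ h4
    congr 1
    rw [sub_smul]
    abel
  exact le_of_tendsto (((hY r hr).sub (hY s hs)).sub tendsto_const_nhds).norm hbound

namespace Network

variable {n N K : ℕ} {m : Fin N → ℕ} {net : Network n N K m}

/-! ### The interconnection -/

theorem ζ_eq_zero_of_consensus (hR : net.NullspaceProperty) {x : ∀ i, Vec (m i)}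
    {z : Fin K → Vec n} {v : Vec n} (h : ∀ i, net.y x z i = v) (k : Fin K) : net.ζ x z k = 0 := by
  have h1 := congrFun ((hR fun _ => 1).2 ⟨1, rfl⟩) k
  simp only [Matrix.mulVec, dotProduct, Matrix.transpose_apply, mul_one, Pi.zero_apply] at h1
  simp [ζ, h, ← Finset.sum_smul, h1]

/-- For each coordinate `c`, the vector of `c`-th output components lies in the kernel of `Rᵀ`. -/
theorem exists_consensus (hR : net.NullspaceProperty) {x : ∀ i, Vec (m i)} {z : Fin K → Vec n}
    (h : ∀ k, net.ζ x z k = 0) : ∃ v : Vec n, ∀ i, net.y x z i = v := by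
  have h1 : ∀ c : Fin n, ∃ α : ℝ, (fun i => net.y x z i c) = fun _ => α := by
    intro c
    refine (hR _).1 (funext fun k => ?_)
    simpa [ζ, Matrix.mulVec, dotProduct] using congrArg (fun w : Vec n => w c) (h k)
  choose α hα using h1
  exact ⟨WithLp.toLp 2 α, fun i => by ext c; exact congrFun (hα c) i⟩

/-- Since `1` lies in the kernel of `Rᵀ`, the columns of `R` sum to zero. This is what balances the
local gradients in the global KKT conditions. -/
theorem sum_u_eq_zero (hR : net.NullspaceProperty) (z : Fin K → Vec n) :
    ∑ i, net.u z i = 0 := by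
  have h1 : ∀ k, ∑ i, net.R i k = 0 := fun k => by
    have h1 := congrFun ((hR fun _ => 1).2 ⟨1, rfl⟩) k
    simpa [Matrix.mulVec, dotProduct] using h1
  simp only [u, Finset.sum_neg_distrib]
  rw [Finset.sum_comm]
  simp [← Finset.sum_smul, h1]

/-- The interconnection preserves power. -/
theorem sum_inner_add_sum_inner (x x₀ : ∀ i, Vec (m i)) (z z₀ : Fin K → Vec n) :
    ∑ i, inner ℝ (net.u z i - net.u z₀ i) (net.y x z i - net.y x₀ z₀ i)
      + ∑ k, inner ℝ (net.ζ x z k - net.ζ x₀ z₀ k) (net.d z k - net.d z₀ k) = 0 := by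
  have h1 : ∀ i, net.u z i - net.u z₀ i = -∑ k, net.R i k • (net.d z k - net.d z₀ k) := by
    intro i
    simp only [u, smul_sub, Finset.sum_sub_distrib]
    abel
  have h2 : ∀ k, net.ζ x z k - net.ζ x₀ z₀ k
      = ∑ i, net.R i k • (net.y x z i - net.y x₀ z₀ i) := by
    intro k
    simp only [ζ, smul_sub, Finset.sum_sub_distrib]
  simp only [h1, h2, inner_neg_left, sum_inner, real_inner_smul_left, Finset.sum_neg_distrib]
  rw [Finset.sum_comm, neg_add_eq_zero]
  exact Finset.sum_congr rfl fun k _ => Finset.sum_congr rfl fun i _ => by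
    rw [real_inner_comm]

theorem IsEquilibrium.ζ_eq_zero (hctrl : ∀ k, (net.controller k).HasIntegralAction)
    {x : ∀ i, Vec (m i)} {z : Fin K → Vec n} (h : net.IsEquilibrium x z) (k : Fin K) :
    net.ζ x z k = 0 :=
  hctrl k _ _ (h.2 k)

/-- The outputs of an equilibrium of the network agree, and are optimal. -/
theorem IsEquilibrium.exists_optimizer {P : DistributedProblem n N} (hP : P.IsRegular)
    (hagent : ∀ i x u, (net.agent i).IsEquilibrium x u →
      P.LocalOptimality i u ((net.agent i).out x u))
    (hctrl : ∀ k, (net.controller k).HasIntegralAction) (hR : net.NullspaceProperty)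
    {x : ∀ i, Vec (m i)} {z : Fin K → Vec n} (h : net.IsEquilibrium x z) :
    ∃ v, (∀ i, net.y x z i = v) ∧ P.IsGlobalOptimizer v := by
  obtain ⟨v, hv⟩ := exists_consensus hR (h.ζ_eq_zero hctrl)
  refine ⟨v, hv, DistributedProblem.isGlobalOptimizer_of_localOptimality hP (u := net.u z)
    (fun i => ?_) (sum_u_eq_zero hR z)⟩
  rw [← hv i]
  exact hagent i _ _ (h.1 i)

/-! ### The vector field of the network -/

/-- The right-hand side of the networked system. -/
noncomputable def field (net : Network n N K m) (p : (∀ i, Vec (m i)) × (Fin K → Vec n)) :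
    (∀ i, Vec (m i)) × (Fin K → Vec n) :=
  (fun i => (net.agent i).dyn (p.1 i) (net.u p.2 i),
    fun k => net.ctrlDyn k (p.2 k) (net.ζ p.1 p.2 k))

theorem continuous_d (hnet : net.IsRegular) : Continuous net.d :=
  continuous_pi fun k => (hnet.continuous_ctrlOut k).comp (continuous_apply k)

theorem continuous_u (hnet : net.IsRegular) (i : Fin N) : Continuous fun z => net.u z i := by
  have := hnet.continuous_ctrlOut
  unfold u d
  fun_prop

theorem continuous_y (hnet : net.IsRegular) (i : Fin N) :
    Continuous fun p : (∀ i, Vec (m i)) × (Fin K → Vec n) => net.y p.1 p.2 i := by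
  have h := (hnet.continuous_agent_out i).comp
    (((continuous_apply (A := fun i => Vec (m i)) i).comp
      (continuous_fst (Y := Fin K → Vec n))).prodMk
      ((continuous_u hnet i).comp continuous_snd))
  exact h

theorem continuous_ζ (hnet : net.IsRegular) (k : Fin K) :
    Continuous fun p : (∀ i, Vec (m i)) × (Fin K → Vec n) => net.ζ p.1 p.2 k :=
  continuous_finsetSum _ fun i _ => (continuous_y hnet i).const_smul (net.R i k)

theorem continuous_field (hnet : net.IsRegular) : Continuous net.field :=
  (continuous_pi fun i => (hnet.continuous_agent_dyn i).comp
    (((continuous_apply i).comp continuous_fst).prodMk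
      ((continuous_u hnet i).comp continuous_snd))).prodMk
  (continuous_pi fun k => (hnet.contDiff_ctrlDyn k).continuous.comp
    (((continuous_apply k).comp continuous_snd).prodMk (continuous_ζ hnet k)))

/-- Packages the network as one autonomous differential equation, the form that
`exists_limit_trajectory` accepts. -/
theorem isTrajectory_iff {x : ℝ → ∀ i, Vec (m i)} {z : ℝ → Fin K → Vec n} :
    net.IsTrajectory x z ↔ ∀ t, 0 ≤ t →
      HasDerivWithinAt (fun t => (x t, z t)) (net.field (x t, z t)) (Set.Ici 0) t := by
  refine forall₂_congr fun t _ => ⟨fun h => ?_, fun h => ⟨?_, ?_⟩⟩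
  · exact (hasDerivWithinAt_pi.2 h.1).prodMk (hasDerivWithinAt_pi.2 h.2)
  · have h1 := ((ContinuousLinearMap.fst ℝ (∀ i, Vec (m i)) (Fin K → Vec n)).hasFDerivAt
      (x := (x t, z t))).comp_hasDerivWithinAt t h
    exact hasDerivWithinAt_pi.1 h1
  · have h1 := ((ContinuousLinearMap.snd ℝ (∀ i, Vec (m i)) (Fin K → Vec n)).hasFDerivAt
      (x := (x t, z t))).comp_hasDerivWithinAt t h
    exact hasDerivWithinAt_pi.1 h1

end Network

/-! ### Storage functions of a single system -/

/-- A sublevel set of a function that tends to infinity is contained in a compact set. -/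
theorem exists_isCompact_of_tendsto_cocompact_atTop {X : Type*} [TopologicalSpace X] {V : X → ℝ}
    (hV : Tendsto V (cocompact X) atTop) (c : ℝ) :
    ∃ C : Set X, IsCompact C ∧ ∀ x, V x ≤ c → x ∈ C := by
  obtain ⟨C, hC, hsub⟩ := mem_cocompact.1 (hV.eventually_gt_atTop c)
  exact ⟨C, hC, fun x hx => by_contra fun h => hx.not_gt (hsub h)⟩

namespace ControlSystem

variable {m n : ℕ} {sys : ControlSystem m n}

/-- The derivative of the storage function along a trajectory. -/
theorem IsEIDissipative.hasDerivWithinAt {w : Vec n → Vec n → Vec m → ℝ} {V : Vec m → Vec m → ℝ}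
    (h : sys.IsEIDissipative w V) {x₀ : Vec m} {u₀ : Vec n} (he : sys.IsEquilibrium x₀ u₀)
    {x : ℝ → Vec m} {x' : Vec m} {t : ℝ} (hx : HasDerivWithinAt x x' (Set.Ici 0) t) :
    HasDerivWithinAt (fun t => V (x t) x₀) (fderiv ℝ (fun a => V a x₀) (x t) x') (Set.Ici 0) t :=
  (((h.contDiff x₀ u₀ he).differentiable one_ne_zero) (x t)).hasFDerivAt.comp_hasDerivWithinAt t hx

theorem IsOutputStrictlyEIP.dissipation {ρ : ℝ} {V : Vec m → Vec m → ℝ}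
    (h : sys.IsOutputStrictlyEIP ρ V) {x₀ : Vec m} {u₀ : Vec n} (he : sys.IsEquilibrium x₀ u₀)
    (x : Vec m) (u : Vec n) :
    fderiv ℝ (fun a => V a x₀) x (sys.dyn x u)
      ≤ inner ℝ (u - u₀) (sys.out x u - sys.out x₀ u₀) - ρ * ‖sys.out x u - sys.out x₀ u₀‖ ^ 2 := by
  obtain ⟨ν, Ψ, hν, hΨ, hd⟩ := h
  refine (hd.dissipation x₀ u₀ he x u).trans ?_
  simp only [passivitySupply]
  have h1 := mul_nonneg hν (real_inner_self_nonneg (x := u - u₀))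
  have h2 := hΨ.2 (x - x₀)
  rw [real_inner_self_eq_norm_sq (sys.out x u - sys.out x₀ u₀)]
  linarith

theorem IsEIP.dissipation {V : Vec m → Vec m → ℝ} (h : sys.IsEIP V) {x₀ : Vec m} {u₀ : Vec n}
    (he : sys.IsEquilibrium x₀ u₀) (x : Vec m) (u : Vec n) :
    fderiv ℝ (fun a => V a x₀) x (sys.dyn x u)
      ≤ inner ℝ (u - u₀) (sys.out x u - sys.out x₀ u₀) := by
  obtain ⟨ρ, ν, Ψ, hρ, hν, hΨ, hd⟩ := h
  refine (IsOutputStrictlyEIP.dissipation ⟨ν, Ψ, hν, hΨ, hd⟩ he x u).trans ?_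
  have h1 := mul_nonneg hρ (sq_nonneg ‖sys.out x u - sys.out x₀ u₀‖)
  linarith

/-- A trajectory with constant input and constant output of a system with steady states does not
move: it starts at a state which is an equilibrium for this input. -/
theorem isEquilibrium_of_constant_output {ρ : ℝ} (hρ : 0 < ρ) {V : Vec m → Vec m → ℝ}
    (hV : sys.IsOutputStrictlyEIP ρ V) (hpos : sys.IsPosDefStorage V) (hobs : sys.IsEIObservable)
    (hss : sys.HasSteadyStates) {x : ℝ → Vec m} {u v : Vec n}
    (hx : ∀ t, 0 ≤ t → HasDerivWithinAt x (sys.dyn (x t) u) (Set.Ici 0) t)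
    (hv : ∀ t, 0 ≤ t → sys.out (x t) u = v) : sys.IsEquilibrium (x 0) u := by
  have hV' := hV
  obtain ⟨ν, Ψ, -, -, hd⟩ := hV'
  rcases hss (x 0) u with ⟨x₀, he⟩ | ⟨u₀, he, hout⟩
  -- The input error is zero, so the storage decreases at least at the constant rate `ρ ‖v - ȳ‖²`.
  -- Being nonnegative, it forces `v = ȳ`, and observability identifies the state.
  · have hnn : 0 ≤ -(ρ * ‖v - sys.out x₀ u‖ ^ 2) :=
      nonneg_of_hasDerivWithinAt_le (fun t ht => hd.hasDerivWithinAt he (hx t ht))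
        (fun t ht => by simpa [hv t ht] using hV.dissipation he (x t) u)
        fun t _ => hd.nonneg x₀ u he (x t)
    have h0 : v = sys.out x₀ u := by
      have h1 : ‖v - sys.out x₀ u‖ ^ 2 ≤ 0 := by
        by_contra! h
        nlinarith [mul_pos hρ h]
      exact sub_eq_zero.1 (norm_eq_zero.1 (pow_eq_zero_iff two_ne_zero |>.1
        (h1.antisymm (sq_nonneg _))))
    rw [hobs x₀ u he x hx (fun t ht => (hv t ht).trans h0) 0 le_rfl]
    exact he
  -- Here the output error is zero, whatever the input error: the storage about `x 0` starts at zero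
  -- and cannot grow, so the state never moves and its velocity under `u` vanishes.
  · have hanti : AntitoneOn (fun t => V (x t) (x 0)) (Set.Ici 0) :=
      antitoneOn_Ici_of_hasDerivWithinAt_nonpos (fun t ht => hd.hasDerivWithinAt he (hx t ht))
        fun t ht => by
          have h1 := hV.dissipation he (x t) u
          rw [hv t ht, hout, hv 0 le_rfl] at h1
          simpa using h1
    have hconst : ∀ t, 0 ≤ t → x t = x 0 := by
      intro t ht
      by_contra hne
      have h1 := hanti (Set.mem_Ici.2 le_rfl) (Set.mem_Ici.2 ht) ht
      have h2 := (hpos _ _ he).1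
      have h3 := (hpos _ _ he).2 _ hne
      simp only [h2] at h1
      linarith
    have h1 : HasDerivWithinAt x 0 (Set.Ici 0) 0 :=
      (hasDerivWithinAt_const 0 _ (x 0)).congr (fun t ht => hconst t ht) rfl
    exact (uniqueDiffWithinAt_Ici 0).eq_deriv _ (hx 0 le_rfl) h1

end ControlSystem

/-! ### The total storage as a Lyapunov function -/

namespace Network

variable {n N K : ℕ} {m : Fin N → ℕ} {net : Network n N K m}
  {ρ : Fin N → ℝ} {S : ∀ i, Vec (m i) → Vec (m i) → ℝ} {W : Fin K → Vec n → Vec n → ℝ}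

/-- `S` and `W` are positive definite, radially unbounded storage functions of output-strictly
passive agents and passive controllers. -/
structure HasStorage (net : Network n N K m) (ρ : Fin N → ℝ)
    (S : ∀ i, Vec (m i) → Vec (m i) → ℝ) (W : Fin K → Vec n → Vec n → ℝ) : Prop where
  index_pos : ∀ i, 0 < ρ i
  agent_passive : ∀ i, (net.agent i).IsOutputStrictlyEIP (ρ i) (S i)
  agent_posDef : ∀ i, (net.agent i).IsPosDefStorage (S i)
  agent_radial : ∀ i, (net.agent i).IsRadiallyUnboundedStorage (S i)
  ctrl_passive : ∀ k, (net.controller k).IsEIP (W k)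
  ctrl_posDef : ∀ k, (net.controller k).IsPosDefStorage (W k)
  ctrl_radial : ∀ k, (net.controller k).IsRadiallyUnboundedStorage (W k)

/-- The sum of the storage functions, relative to the state `p₀`. -/
noncomputable def storage (S : ∀ i, Vec (m i) → Vec (m i) → ℝ) (W : Fin K → Vec n → Vec n → ℝ)
    (p₀ p : (∀ i, Vec (m i)) × (Fin K → Vec n)) : ℝ :=
  ∑ i, S i (p.1 i) (p₀.1 i) + ∑ k, W k (p.2 k) (p₀.2 k)

theorem IsEquilibrium.agent {x : ∀ i, Vec (m i)} {z : Fin K → Vec n} (h : net.IsEquilibrium x z)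
    (i : Fin N) : (net.agent i).IsEquilibrium (x i) (net.u z i) := h.1 i

theorem IsEquilibrium.ctrl {x : ∀ i, Vec (m i)} {z : Fin K → Vec n} (h : net.IsEquilibrium x z)
    (k : Fin K) : (net.controller k).IsEquilibrium (z k) (net.ζ x z k) := h.2 k

variable {p₀ : (∀ i, Vec (m i)) × (Fin K → Vec n)}

theorem HasStorage.agent_nonneg (hs : net.HasStorage ρ S W) (h₀ : net.IsEquilibrium p₀.1 p₀.2)
    (i : Fin N) (x : Vec (m i)) : 0 ≤ S i x (p₀.1 i) := by
  obtain ⟨ν, Ψ, -, -, hd⟩ := hs.agent_passive i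
  exact hd.nonneg _ _ (h₀.agent i) x

theorem HasStorage.ctrl_nonneg (hs : net.HasStorage ρ S W) (h₀ : net.IsEquilibrium p₀.1 p₀.2)
    (k : Fin K) (z : Vec n) : 0 ≤ W k z (p₀.2 k) := by
  obtain ⟨ρ', ν, Ψ, -, -, -, hd⟩ := hs.ctrl_passive k
  exact hd.nonneg _ _ (h₀.ctrl k) z

theorem HasStorage.storage_nonneg (hs : net.HasStorage ρ S W) (h₀ : net.IsEquilibrium p₀.1 p₀.2)
    (p : (∀ i, Vec (m i)) × (Fin K → Vec n)) : 0 ≤ storage S W p₀ p :=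
  add_nonneg (Finset.sum_nonneg fun i _ => hs.agent_nonneg h₀ i _)
    (Finset.sum_nonneg fun k _ => hs.ctrl_nonneg h₀ k _)

theorem HasStorage.agent_le_storage (hs : net.HasStorage ρ S W)
    (h₀ : net.IsEquilibrium p₀.1 p₀.2) (p : (∀ i, Vec (m i)) × (Fin K → Vec n)) (i : Fin N) :
    S i (p.1 i) (p₀.1 i) ≤ storage S W p₀ p :=
  (Finset.single_le_sum (f := fun i => S i (p.1 i) (p₀.1 i))
    (fun i _ => hs.agent_nonneg h₀ i _) (Finset.mem_univ i)).trans
    (le_add_of_nonneg_right (Finset.sum_nonneg fun k _ => hs.ctrl_nonneg h₀ k _))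

theorem HasStorage.ctrl_le_storage (hs : net.HasStorage ρ S W)
    (h₀ : net.IsEquilibrium p₀.1 p₀.2) (p : (∀ i, Vec (m i)) × (Fin K → Vec n)) (k : Fin K) :
    W k (p.2 k) (p₀.2 k) ≤ storage S W p₀ p :=
  (Finset.single_le_sum (f := fun k => W k (p.2 k) (p₀.2 k))
    (fun k _ => hs.ctrl_nonneg h₀ k _) (Finset.mem_univ k)).trans
    (le_add_of_nonneg_left (Finset.sum_nonneg fun i _ => hs.agent_nonneg h₀ i _))

theorem HasStorage.storage_self (hs : net.HasStorage ρ S W) (h₀ : net.IsEquilibrium p₀.1 p₀.2) :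
    storage S W p₀ p₀ = 0 := by
  simp [storage, fun i => (hs.agent_posDef i _ _ (h₀.agent i)).1,
    fun k => (hs.ctrl_posDef k _ _ (h₀.ctrl k)).1]

theorem HasStorage.eq_of_storage_eq_zero (hs : net.HasStorage ρ S W)
    (h₀ : net.IsEquilibrium p₀.1 p₀.2) {p : (∀ i, Vec (m i)) × (Fin K → Vec n)}
    (hp : storage S W p₀ p = 0) : p = p₀ := by
  refine Prod.ext (funext fun i => ?_) (funext fun k => ?_)
  · by_contra hne
    have h1 := (hs.agent_posDef i _ _ (h₀.agent i)).2 _ hne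
    linarith [hs.agent_le_storage h₀ p i]
  · by_contra hne
    have h1 := (hs.ctrl_posDef k _ _ (h₀.ctrl k)).2 _ hne
    linarith [hs.ctrl_le_storage h₀ p k]

theorem HasStorage.continuous_storage (hs : net.HasStorage ρ S W)
    (h₀ : net.IsEquilibrium p₀.1 p₀.2) : Continuous (storage S W p₀) := by
  refine (continuous_finsetSum _ fun i _ => ?_).add (continuous_finsetSum _ fun k _ => ?_)
  · obtain ⟨ν, Ψ, -, -, hd⟩ := hs.agent_passive i
    exact (hd.contDiff _ _ (h₀.agent i)).continuous.comp
      ((continuous_apply i).comp continuous_fst)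
  · obtain ⟨ρ', ν, Ψ, -, -, -, hd⟩ := hs.ctrl_passive k
    exact (hd.contDiff _ _ (h₀.ctrl k)).continuous.comp
      ((continuous_apply k).comp continuous_snd)

/-- Each summand is bounded by the total because the others are nonnegative, so a product of compact
sets works. -/
theorem HasStorage.exists_isCompact (hs : net.HasStorage ρ S W)
    (h₀ : net.IsEquilibrium p₀.1 p₀.2) (c : ℝ) :
    ∃ C : Set ((∀ i, Vec (m i)) × (Fin K → Vec n)), IsCompact C ∧
      ∀ p, storage S W p₀ p ≤ c → p ∈ C := by
  choose A hA hAc using fun i =>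
    exists_isCompact_of_tendsto_cocompact_atTop (hs.agent_radial i _ _ (h₀.agent i)) c
  choose B hB hBc using fun k =>
    exists_isCompact_of_tendsto_cocompact_atTop (hs.ctrl_radial k _ _ (h₀.ctrl k)) c
  exact ⟨_, (isCompact_univ_pi hA).prod (isCompact_univ_pi hB), fun p hp =>
    ⟨fun i _ => hAc i _ ((hs.agent_le_storage h₀ p i).trans hp),
      fun k _ => hBc k _ ((hs.ctrl_le_storage h₀ p k).trans hp)⟩⟩

/-- Along trajectories the total storage decreases at least at the rate given by the output
errors. -/
theorem HasStorage.exists_hasDerivWithinAt (hs : net.HasStorage ρ S W)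
    (h₀ : net.IsEquilibrium p₀.1 p₀.2) {x : ℝ → ∀ i, Vec (m i)} {z : ℝ → Fin K → Vec n}
    (h : net.IsTrajectory x z) :
    ∃ r : ℝ → ℝ, ∀ t, 0 ≤ t →
      HasDerivWithinAt (fun t => storage S W p₀ (x t, z t)) (r t) (Set.Ici 0) t ∧
      r t ≤ -∑ i, ρ i * ‖net.y (x t) (z t) i - net.y p₀.1 p₀.2 i‖ ^ 2 := by
  refine ⟨fun t => ∑ i, fderiv ℝ (fun a => S i a (p₀.1 i)) (x t i)
        ((net.agent i).dyn (x t i) (net.u (z t) i))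
      + ∑ k, fderiv ℝ (fun a => W k a (p₀.2 k)) (z t k)
        (net.ctrlDyn k (z t k) (net.ζ (x t) (z t) k)), fun t ht => ⟨?_, ?_⟩⟩
  · refine (HasDerivWithinAt.fun_sum fun i _ => ?_).add (HasDerivWithinAt.fun_sum fun k _ => ?_)
    · obtain ⟨ν, Ψ, -, -, hd⟩ := hs.agent_passive i
      exact hd.hasDerivWithinAt (h₀.agent i) ((h t ht).1 i)
    · obtain ⟨ρ', ν, Ψ, -, -, -, hd⟩ := hs.ctrl_passive k
      exact hd.hasDerivWithinAt (h₀.ctrl k) ((h t ht).2 k)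
  · have h1 := Finset.sum_le_sum fun i (_ : i ∈ Finset.univ) =>
      (hs.agent_passive i).dissipation (h₀.agent i) (x t i) (net.u (z t) i)
    have h2 := Finset.sum_le_sum fun k (_ : k ∈ Finset.univ) =>
      (hs.ctrl_passive k).dissipation (h₀.ctrl k) (z t k) (net.ζ (x t) (z t) k)
    -- The supplies of agents and controllers cancel, leaving only the output-strictness terms.
    have h3 := sum_inner_add_sum_inner (net := net) (x t) p₀.1 (z t) p₀.2
    rw [Finset.sum_sub_distrib] at h1
    simp only [controller] at h2
    simp only [y, d] at h3 ⊢
    linarith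

theorem HasStorage.rate_nonpos (hs : net.HasStorage ρ S W) (v v₀ : Fin N → Vec n) :
    -∑ i, ρ i * ‖v i - v₀ i‖ ^ 2 ≤ 0 :=
  neg_nonpos.2 (Finset.sum_nonneg fun i _ => mul_nonneg (hs.index_pos i).le (sq_nonneg _))

theorem HasStorage.antitoneOn_storage (hs : net.HasStorage ρ S W)
    (h₀ : net.IsEquilibrium p₀.1 p₀.2) {x : ℝ → ∀ i, Vec (m i)} {z : ℝ → Fin K → Vec n}
    (h : net.IsTrajectory x z) :
    AntitoneOn (fun t => storage S W p₀ (x t, z t)) (Set.Ici 0) := by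
  obtain ⟨r, hr⟩ := hs.exists_hasDerivWithinAt h₀ h
  exact antitoneOn_Ici_of_hasDerivWithinAt_nonpos (fun t ht => (hr t ht).1)
    fun t ht => (hr t ht).2.trans (hs.rate_nonpos _ _)

/-! ### Invariance principle and convergence -/

/-- Every trajectory converges, along every ultrafilter of times tending to infinity, to the
initial state of a trajectory whose agent outputs stay at their equilibrium values. -/
theorem HasStorage.exists_limit_trajectory (hs : net.HasStorage ρ S W) (hnet : net.IsRegular)
    (h₀ : net.IsEquilibrium p₀.1 p₀.2) {x : ℝ → ∀ i, Vec (m i)} {z : ℝ → Fin K → Vec n}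
    (h : net.IsTrajectory x z) {U : Ultrafilter ℝ} (hU : (U : Filter ℝ) ≤ atTop) :
    ∃ (x' : ℝ → ∀ i, Vec (m i)) (z' : ℝ → Fin K → Vec n), net.IsTrajectory x' z' ∧
      Tendsto (fun t => (x t, z t)) U (𝓝 (x' 0, z' 0)) ∧
      ∀ s, 0 ≤ s → ∀ i, net.y (x' s) (z' s) i = net.y p₀.1 p₀.2 i := by
  obtain ⟨C, hC, hmem⟩ := hs.exists_isCompact h₀ (storage S W p₀ (x 0, z 0))
  have hanti := hs.antitoneOn_storage h₀ h
  obtain ⟨Y, hlim, hY⟩ := _root_.exists_limit_trajectory (continuous_field hnet)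
    (isTrajectory_iff.1 h) hC
    (fun t ht => hmem _ (hanti (Set.mem_Ici.2 le_rfl) (Set.mem_Ici.2 ht) ht)) hU
  have htraj : net.IsTrajectory (fun t => (Y t).1) fun t => (Y t).2 := isTrajectory_iff.2 hY
  refine ⟨_, _, htraj, by simpa using hlim 0 le_rfl, fun s hs0 => ?_⟩
  obtain ⟨L, hL⟩ := hanti.exists_tendsto_atTop fun t _ => hs.storage_nonneg h₀ _
  -- Shifting time does not change the limit `L` of the storage, so the limit trajectory stays on
  -- one level set. Its storage then has derivative zero, which forces every term of the dissipation
  -- to vanish.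
  have hconst : ∀ s, 0 ≤ s → storage S W p₀ (Y s) = L := fun s hs0 =>
    tendsto_nhds_unique (((hs.continuous_storage h₀).tendsto _).comp (hlim s hs0))
      (hL.comp ((tendsto_atTop_add_const_right _ s tendsto_id).mono_left hU))
  obtain ⟨r, hr⟩ := hs.exists_hasDerivWithinAt h₀ htraj
  have hr0 : r s = 0 :=
    (uniqueDiffOn_Ici 0 s hs0).eq_deriv _ (hr s hs0).1
      ((hasDerivWithinAt_const s _ L).congr (fun t ht => hconst t ht) (hconst s hs0))
  have hle := (hr s hs0).2
  rw [hr0] at hle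
  have hterm : ∀ i ∈ Finset.univ,
      0 ≤ ρ i * ‖net.y (Y s).1 (Y s).2 i - net.y p₀.1 p₀.2 i‖ ^ 2 :=
    fun i _ => mul_nonneg (hs.index_pos i).le (sq_nonneg _)
  have hzero := (Finset.sum_eq_zero_iff_of_nonneg hterm).1
    (le_antisymm (by linarith) (Finset.sum_nonneg hterm))
  intro i
  have hi := hzero i (Finset.mem_univ i)
  exact sub_eq_zero.1 (norm_eq_zero.1 (pow_eq_zero_iff two_ne_zero |>.1
    ((mul_eq_zero.1 hi).resolve_left (hs.index_pos i).ne')))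

/-- Trajectories whose agent outputs are constant and equal start at an equilibrium. -/
theorem HasStorage.isEquilibrium_of_constant_output (hs : net.HasStorage ρ S W)
    (hrest : ∀ k z, net.ctrlDyn k z 0 = 0) (hR : net.NullspaceProperty)
    (hobs : ∀ i, (net.agent i).IsEIObservable) (hss : ∀ i, (net.agent i).HasSteadyStates)
    {x : ℝ → ∀ i, Vec (m i)} {z : ℝ → Fin K → Vec n} (h : net.IsTrajectory x z) {v : Vec n}
    (hv : ∀ t, 0 ≤ t → ∀ i, net.y (x t) (z t) i = v) : net.IsEquilibrium (x 0) (z 0) := by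
  have hζ : ∀ t, 0 ≤ t → ∀ k, net.ζ (x t) (z t) k = 0 := fun t ht =>
    ζ_eq_zero_of_consensus hR (hv t ht)
  -- With zero input the controllers are at rest, so the agents receive constant inputs.
  have hz : ∀ t, 0 ≤ t → z t = z 0 := by
    intro t ht
    funext k
    have h1 : ‖z t k - z 0 k‖ ≤ 0 * ‖t - 0‖ :=
      Convex.norm_image_sub_le_of_norm_hasDerivWithin_le (f := fun t => z t k)
        (fun s hs => (h s hs).2 k)
        (fun s hs => by rw [hζ s hs, hrest, norm_zero]) (convex_Ici 0) (Set.mem_Ici.2 le_rfl) ht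
    rw [zero_mul] at h1
    exact sub_eq_zero.1 (norm_le_zero_iff.1 h1)
  refine ⟨fun i => ?_, fun k => by rw [hζ 0 le_rfl, hrest]⟩
  refine ControlSystem.isEquilibrium_of_constant_output (hs.index_pos i) (hs.agent_passive i)
    (hs.agent_posDef i) (hobs i) (hss i) (x := fun t => x t i) (v := v) (fun t ht => ?_)
    fun t ht => ?_
  · have h1 := (h t ht).1 i
    rwa [hz t ht] at h1
  · have h1 := hv t ht i
    rwa [y, hz t ht] at h1

/-- A trajectory that accumulates at an equilibrium converges to it. -/
theorem HasStorage.tendsto_of_tendsto_ultrafilter (hs : net.HasStorage ρ S W)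
    (hnet : net.IsRegular) (h₀ : net.IsEquilibrium p₀.1 p₀.2) {x : ℝ → ∀ i, Vec (m i)}
    {z : ℝ → Fin K → Vec n} (h : net.IsTrajectory x z) {U : Ultrafilter ℝ}
    (hU : (U : Filter ℝ) ≤ atTop) (hlim : Tendsto (fun t => (x t, z t)) U (𝓝 p₀)) :
    Tendsto (fun t => (x t, z t)) atTop (𝓝 p₀) := by
  obtain ⟨L, hL⟩ := (hs.antitoneOn_storage h₀ h).exists_tendsto_atTop
    fun t _ => hs.storage_nonneg h₀ _
  have hcont := hs.continuous_storage h₀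
  have hL0 : L = 0 := by
    rw [← hs.storage_self h₀]
    exact tendsto_nhds_unique (hL.mono_left hU) ((hcont.tendsto _).comp hlim)
  -- Along any other ultrafilter the limit also has storage `L = 0`, and positive definiteness makes
  -- it `p₀`.
  refine (tendsto_iff_ultrafilter _ _ _).2 fun U' hU' => ?_
  obtain ⟨x', z', -, hlim', -⟩ := hs.exists_limit_trajectory hnet h₀ h hU'
  have h0 : storage S W p₀ (x' 0, z' 0) = 0 := by
    exact (tendsto_nhds_unique ((hcont.tendsto _).comp hlim') (hL.mono_left hU')).trans hL0
  rwa [hs.eq_of_storage_eq_zero h₀ h0] at hlim'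

end Network

theorem mainTheorem3 {n N K : ℕ} {m : Fin N → ℕ}
    (P : DistributedProblem n N) (hP : P.IsRegular)
    (net : Network n N K m) (hnet : net.IsRegular)
    -- steady-state requirements and integral action
    (hagent : ∀ i x u, (net.agent i).IsEquilibrium x u →
      P.LocalOptimality i u ((net.agent i).out x u))
    (hctrl : ∀ k, (net.controller k).HasIntegralAction)
    -- communication structure
    (hR : net.NullspaceProperty)
    -- passivity and observability of the agents
    (ρ : Fin N → ℝ) (hρ : ∀ i, 0 < ρ i)
    (S : ∀ i, Vec (m i) → Vec (m i) → ℝ)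
    (hS : ∀ i, (net.agent i).IsOutputStrictlyEIP (ρ i) (S i))
    (hSpos : ∀ i, (net.agent i).IsPosDefStorage (S i))
    (hSrad : ∀ i, (net.agent i).IsRadiallyUnboundedStorage (S i))
    (hSobs : ∀ i, (net.agent i).IsEIObservable)
    -- passivity and observability of the controllers
    (W : Fin K → Vec n → Vec n → ℝ)
    (hW : ∀ k, (net.controller k).IsEIP (W k))
    (hWpos : ∀ k, (net.controller k).IsPosDefStorage (W k))
    (hWrad : ∀ k, (net.controller k).IsRadiallyUnboundedStorage (W k))
    (hWobs : ∀ k, (net.controller k).IsEIObservable)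
    -- the networked system has an equilibrium
    (heq : ∃ x z, net.IsEquilibrium x z) :
    ∃ yopt : Vec n,
      P.IsGlobalOptimizer yopt ∧ (∀ y, P.IsGlobalOptimizer y → y = yopt) ∧
      (∀ x z, net.IsEquilibrium x z →
        (net.y x z, net.d z) ∈ equilibriumManifold N K yopt) ∧
      ∀ (x : ℝ → ∀ i, Vec (m i)) (z : ℝ → Fin K → Vec n), net.IsTrajectory x z →
        (∀ i, Tendsto (fun t => net.y (x t) (z t) i) atTop (𝓝 yopt)) ∧
        ((∀ i, (net.agent i).HasSteadyStates) →
          ∃ (xlim : ∀ i, Vec (m i)) (zlim : Fin K → Vec n),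
            net.IsEquilibrium xlim zlim ∧
            (net.y xlim zlim, net.d zlim) ∈ equilibriumManifold N K yopt ∧
            Tendsto x atTop (𝓝 xlim) ∧ Tendsto z atTop (𝓝 zlim) ∧
            Tendsto (fun t => (net.y (x t) (z t), net.d (z t))) atTop
              (𝓝 (net.y xlim zlim, net.d zlim))) := by
  obtain ⟨x₀, z₀, h₀⟩ := heq
  have hs : net.HasStorage ρ S W := ⟨hρ, hS, hSpos, hSrad, hW, hWpos, hWrad⟩
  obtain ⟨yopt, hy₀, hopt⟩ := h₀.exists_optimizer hP hagent hctrl hR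
  have huniq : ∀ y, P.IsGlobalOptimizer y → y = yopt := fun y hy => hopt.unique hP hy
  have hout : ∀ x z, net.IsEquilibrium x z →
      (net.y x z, net.d z) ∈ equilibriumManifold N K yopt := by
    intro x z h i
    obtain ⟨v, hv, hvopt⟩ := h.exists_optimizer hP hagent hctrl hR
    exact (hv i).trans (huniq v hvopt)
  refine ⟨yopt, hopt, huniq, hout, fun x z htraj => ⟨fun i => ?_, fun hss => ?_⟩⟩
  · refine (tendsto_iff_ultrafilter _ _ _).2 fun U hU => ?_
    obtain ⟨x', z', -, hlim, hy⟩ :=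
      hs.exists_limit_trajectory hnet (p₀ := (x₀, z₀)) h₀ htraj hU
    have h1 := ((Network.continuous_y hnet i).tendsto _).comp hlim
    simp only [hy 0 le_rfl i, hy₀] at h1
    exact h1
  · have hrest : ∀ k z, net.ctrlDyn k z 0 = 0 := fun k z =>
      Network.ctrlDyn_zero hnet (hctrl k) (hW k) (hWpos k) (z₀ := z₀ k)
        (h₀.ζ_eq_zero hctrl k ▸ h₀.2 k) z
    -- One ultrafilter is enough: it supplies an accumulation point, and the storage recentred there
    -- gives convergence along `atTop`.
    have hU : ((Ultrafilter.of atTop : Ultrafilter ℝ) : Filter ℝ) ≤ atTop := Ultrafilter.of_le atTop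
    obtain ⟨x', z', htraj', hlim, hy⟩ :=
      hs.exists_limit_trajectory hnet (p₀ := (x₀, z₀)) h₀ htraj hU
    have heq' : net.IsEquilibrium (x' 0) (z' 0) :=
      hs.isEquilibrium_of_constant_output hrest hR hSobs hss htraj' (v := yopt)
        fun t ht i => (hy t ht i).trans (hy₀ i)
    have hconv := hs.tendsto_of_tendsto_ultrafilter hnet (p₀ := (x' 0, z' 0)) heq' htraj hU hlim
    have hcont : Continuous fun p : (∀ i, Vec (m i)) × (Fin K → Vec n) =>
        (net.y p.1 p.2, net.d p.2) :=
      (continuous_pi fun i => Network.continuous_y hnet i).prodMk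
        ((Network.continuous_d hnet).comp continuous_snd)
    exact ⟨x' 0, z' 0, heq', hout _ _ heq', (continuous_fst.tendsto _).comp hconv,
      (continuous_snd.tendsto _).comp hconv, (hcont.tendsto _).comp hconv⟩
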